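/- Let $0<r<1$ and $R(r,1)=\{z\in\mathbb{C} : r<|z|<1\}$. On $\overline{\mathbb{C}}=\mathbb{C}\cup\{\infty\}$ let $|a,b,c,d|=\frac{q(a,c)\,q(b,d)}{q(a,b)\,q(c,d)}$ be the absolute cross-ratio, where $q$ is the chordal metric, $q(x,y)=\frac{|x-y|}{\sqrt{1+|x|^2}\sqrt{1+|y|^2}}$ and $q(x,\infty)=\frac{1}{\sqrt{1+|x|^2}}$ (so $|a,b,c,d|=\frac{|a-c||b-d|}{|a-b||c-d|}$ for finite points). For a domain $G\subset\overline{\mathbb{C}}$ whose complement has at least two points, the Möbius metric is $\delta_G(x,y)=\sup_{a,b\in\partial G}\log(1+|a,x,b,y|)$, with the boundary taken in $\overline{\mathbb{C}}$. Let $\rho_{\mathbb{B}^2}$ be the hyperbolic metric of the unit disk, given by $\sinh^2\frac{\rho_{\mathbb{B}^2}(x,y)}{2}=\frac{|x-y|^2}{(1-|x|^2)(1-|y|^2)}$. Let $x,y\in R(r,1)$ with $|y|\le|x|$, and let $\mu\in[0,\pi]$ be the angle at the origin between the vectors $x$ and $y$. For $v\in[\mu,\pi]$ put $$c_1=|x|^2(1+r^2)^2+r^2(1+|x|^2)^2-2r|x|(1+r^2)(1+|x|^2)\cos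 v,$$ $$c_2=4r|x|\sin v\,\bigl(|x|(1+r^2)-r(1+|x|^2)\cos v\bigr),\qquad c_3=-r^2\sin^2 v\,(1-|x|^2)^2,$$ $$u(v)=\arcsin\left(\frac{-c_2+\sqrt{c_2^2-4c_1c_3}}{2c_1}\right).$$ Then, for all $v\in[\mu,\pi]$, $c_1>0$, $c_2^2-4c_1c_3\ge 0$ and the argument of $\arcsin$ lies in $[0,1]$; both suprema (the one defining $\delta_{R(r,1)}(x,y)$ and the one below) are finite; and $$\delta_{R(r,1)}(x,y)=\max\left\{\rho_{\mathbb{B}^2}(x,y),\ \rho_{\mathbb{B}^2}\left(\frac{rx}{|x|^2},\frac{ry}{|y|^2}\right),\ \sup_{v\in[\mu,\pi]}\log\bigl(1+\bigl|e^{-u(v)i},|x|,re^{vi},|y|e^{\mu i}\bigr|\bigr)\right\}.$$ -/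

import Mathlib

open scoped OnePoint

noncomputable section

/-- The ring `R(r,1) = {z ∈ ℂ : r < |z| < 1}`. -/
def annularRing (r : ℝ) : Set ℂ := {z : ℂ | r < ‖z‖ ∧ ‖z‖ < 1}

/-- The chordal metric `q` on the extended plane `ℂ ∪ {∞}`. -/
def chordalDist : OnePoint ℂ → OnePoint ℂ → ℝ
  | ∞, ∞ => 0
  | ∞, OnePoint.some y => 1 / √(1 + ‖y‖ ^ 2)
  | OnePoint.some x, ∞ => 1 / √(1 + ‖x‖ ^ 2)
  | OnePoint.some x, OnePoint.some y => ‖x - y‖ / (√(1 + ‖x‖ ^ 2) * √(1 + ‖y‖ ^ 2))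

/-- The absolute cross-ratio `|a,b,c,d| = q(a,c) q(b,d) / (q(a,b) q(c,d))`. -/
def absCrossRatio (a b c d : OnePoint ℂ) : ℝ :=
  (chordalDist a c * chordalDist b d) / (chordalDist a b * chordalDist c d)

/-- For finite points the cross-ratio is `|a - c| |b - d| / (|a - b| |c - d|)`. -/
theorem absCrossRatio_coe (a b c d : ℂ) :
    absCrossRatio (a : OnePoint ℂ) (b : OnePoint ℂ) (c : OnePoint ℂ) (d : OnePoint ℂ)
      = (‖a - c‖ * ‖b - d‖) / (‖a - b‖ * ‖c - d‖) := by
  have h : ∀ z : ℂ, √(1 + ‖z‖ ^ 2) ≠ 0 := fun z => (Real.sqrt_pos.2 (by positivity)).ne'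
  have ha := h a
  have hb := h b
  have hc := h c
  have hd := h d
  simp only [absCrossRatio, chordalDist]
  rw [div_mul_div_comm, div_mul_div_comm]
  rw [show √(1 + ‖a‖ ^ 2) * √(1 + ‖c‖ ^ 2) * (√(1 + ‖b‖ ^ 2) * √(1 + ‖d‖ ^ 2))
      = √(1 + ‖a‖ ^ 2) * √(1 + ‖b‖ ^ 2) * (√(1 + ‖c‖ ^ 2) * √(1 + ‖d‖ ^ 2)) by ring]
  exact div_div_div_cancel_right₀ (by positivity) _ _

/-- The values `log (1 + |a,x,b,y|)`, where `a`, `b` run over the boundary of `G` taken in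
the extended plane. -/
def mobiusValues (G : Set (OnePoint ℂ)) (x y : OnePoint ℂ) : Set ℝ :=
  {t : ℝ | ∃ a ∈ frontier G, ∃ b ∈ frontier G, t = Real.log (1 + absCrossRatio a x b y)}

/-- The Möbius metric `δ_G(x,y) = sup_{a,b ∈ ∂G} log (1 + |a,x,b,y|)`. -/
def mobiusMetric (G : Set (OnePoint ℂ)) (x y : OnePoint ℂ) : ℝ :=
  sSup (mobiusValues G x y)

/-- The hyperbolic metric `ρ` of the unit disk, determined by
`sinh² (ρ(x,y) / 2) = |x - y|² / ((1 - |x|²) (1 - |y|²))`. -/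
def diskHypDist (x y : ℂ) : ℝ :=
  2 * Real.arsinh (‖x - y‖ / √((1 - ‖x‖ ^ 2) * (1 - ‖y‖ ^ 2)))

/-- The coefficient `c₁`, as a function of `r`, of `s = |x|` and of `v`. -/
def coeffOne (r s v : ℝ) : ℝ :=
  s ^ 2 * (1 + r ^ 2) ^ 2 + r ^ 2 * (1 + s ^ 2) ^ 2
    - 2 * r * s * (1 + r ^ 2) * (1 + s ^ 2) * Real.cos v

/-- The coefficient `c₂`. -/
def coeffTwo (r s v : ℝ) : ℝ :=
  4 * r * s * Real.sin v * (s * (1 + r ^ 2) - r * (1 + s ^ 2) * Real.cos v)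

/-- The coefficient `c₃`. -/
def coeffThree (r s v : ℝ) : ℝ :=
  -(r ^ 2 * Real.sin v ^ 2 * (1 - s ^ 2) ^ 2)

/-- The discriminant `c₂² - 4 c₁ c₃`. -/
def ringDiscr (r s v : ℝ) : ℝ :=
  coeffTwo r s v ^ 2 - 4 * coeffOne r s v * coeffThree r s v

/-- The root `(-c₂ + √(c₂² - 4 c₁ c₃)) / (2 c₁)`. -/
def ringRoot (r s v : ℝ) : ℝ :=
  (-coeffTwo r s v + √(ringDiscr r s v)) / (2 * coeffOne r s v)

/-- `u(v) = arcsin ((-c₂ + √(c₂² - 4 c₁ c₃)) / (2 c₁))`. -/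
def ringAngle (r s v : ℝ) : ℝ := Real.arcsin (ringRoot r s v)

/-- `log (1 + |e^{-u(v) i}, |x|, r e^{v i}, |y| e^{μ i}|)`, where `μ ∈ [0, π]` is the angle
at the origin between `x` and `y`. -/
def ringValue (r : ℝ) (x y : ℂ) (v : ℝ) : ℝ :=
  Real.log (1 + absCrossRatio
    (Complex.exp (-(ringAngle r ‖x‖ v : ℂ) * Complex.I) : ℂ)
    ((‖x‖ : ℂ) : OnePoint ℂ)
    ((r : ℂ) * Complex.exp ((v : ℂ) * Complex.I) : ℂ)
    ((‖y‖ : ℂ) * Complex.exp ((InnerProductGeometry.angle x y : ℂ) * Complex.I) : ℂ))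

end

/-! The boundary of the ring in the extended plane is the two circles `|z| = 1` and `|z| = r`, so
the supremum splits according to where `a` and `b` lie; each class has a maximum, which yields the
formula and both finiteness claims. If both lie on the unit circle, the maximum is the hyperbolic
distance of the disk (`log_absCrossRatio_le_diskHypDist`,
`exists_log_absCrossRatio_eq_diskHypDist`). If both lie on the inner circle, `z ↦ r / conj z`
preserves the cross-ratio and exchanges the circles, reducing to the first case. For mixed pairs, an
isometry moves `x` to `s > 0` and `y` to `t e^{μi}`. With `b = r e^{vi}` and `v ∈ [0, π]` fixed, the
best point of the unit circle is `e^{-u(v)i}` (`ringAngle_optimal`). Symmetry and monotonicity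
confine `v` to `[μ, π]` (`exists_mixed_max`). Having `a` on the inner circle and `b` on the outer
one gives nothing larger, because `|y| ≤ |x|` (`inner_outer_le_outer_inner`). -/

open scoped ComplexConjugate

/-! ### The optimal angle on the unit circle for a fixed point of the inner circle. -/

section RingAngle

variable {r s : ℝ}

theorem ring_slope_pos (hr : 0 < r) (hrs : r < s) (hs : s < 1) (v : ℝ) :
    0 < s * (1 + r ^ 2) - r * (1 + s ^ 2) * Real.cos v := by
  have h1 : 0 < (s - r) * (1 - r * s) :=
    mul_pos (sub_pos.2 hrs) (by nlinarith)
  have h2 : r * (1 + s ^ 2) * Real.cos v ≤ r * (1 + s ^ 2) * 1 :=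
    mul_le_mul_of_nonneg_left (Real.cos_le_one v) (by positivity)
  nlinarith

/-- With `P = s(1+r²) - r(1+s²) cos v`, `Q = r(1+s²) sin v` and `K = 2rs sin v`, the critical
equation is `Q cos u = K + P sin u`. Squaring it gives a quadratic in `sin u` with coefficients `c₁
= P² + Q²`, `c₂ = 2KP`, `c₃ = K² - Q²`. -/
theorem coeffOne_eq (r s v : ℝ) :
    coeffOne r s v = (s * (1 + r ^ 2) - r * (1 + s ^ 2) * Real.cos v) ^ 2
      + (r * (1 + s ^ 2) * Real.sin v) ^ 2 := by
  unfold coeffOne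
  linear_combination (-(r ^ 2 * (1 + s ^ 2) ^ 2)) * Real.sin_sq_add_cos_sq v

theorem coeffOne_pos (hr : 0 < r) (hrs : r < s) (hs : s < 1) (v : ℝ) :
    0 < coeffOne r s v := by
  have := ring_slope_pos hr hrs hs v
  rw [coeffOne_eq]
  positivity

theorem sq_coeffTwo_le_ringDiscr (hr : 0 < r) (hrs : r < s) (hs : s < 1) (v : ℝ) :
    coeffTwo r s v ^ 2 ≤ ringDiscr r s v := by
  have h1 := coeffOne_pos hr hrs hs v
  have h3 : coeffOne r s v * coeffThree r s v ≤ 0 :=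
    mul_nonpos_of_nonneg_of_nonpos h1.le (by unfold coeffThree; simp; positivity)
  unfold ringDiscr
  linarith

theorem ringDiscr_nonneg (hr : 0 < r) (hrs : r < s) (hs : s < 1) (v : ℝ) :
    0 ≤ ringDiscr r s v :=
  (sq_nonneg _).trans (sq_coeffTwo_le_ringDiscr hr hrs hs v)

theorem ringRoot_quadratic (hr : 0 < r) (hrs : r < s) (hs : s < 1) (v : ℝ) :
    coeffOne r s v * ringRoot r s v ^ 2 + coeffTwo r s v * ringRoot r s v
      + coeffThree r s v = 0 := by
  have h1 := (coeffOne_pos hr hrs hs v).ne'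
  have h := Real.sq_sqrt (ringDiscr_nonneg hr hrs hs v)
  have hroot : 2 * coeffOne r s v * ringRoot r s v
      = -coeffTwo r s v + √(ringDiscr r s v) := by
    unfold ringRoot
    field_simp
  have h4 : 4 * coeffOne r s v * (coeffOne r s v * ringRoot r s v ^ 2
      + coeffTwo r s v * ringRoot r s v + coeffThree r s v) = 0 := by
    have hd : ringDiscr r s v
        = coeffTwo r s v ^ 2 - 4 * coeffOne r s v * coeffThree r s v := rfl
    have hs' : √(ringDiscr r s v) = 2 * coeffOne r s v * ringRoot r s v + coeffTwo r s v := by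
      linarith
    rw [hs'] at h
    linear_combination h + hd
  exact (mul_eq_zero.1 h4).resolve_left (by simpa using h1)

theorem coeffTwo_nonneg (hr : 0 < r) (hrs : r < s) (hs : s < 1) {v : ℝ}
    (hv : v ∈ Set.Icc 0 Real.pi) : 0 ≤ coeffTwo r s v := by
  have := ring_slope_pos hr hrs hs v
  have := Real.sin_nonneg_of_mem_Icc hv
  have : 0 < s := hr.trans hrs
  unfold coeffTwo
  positivity

theorem ringRoot_mem_Icc (hr : 0 < r) (hrs : r < s) (hs : s < 1) {v : ℝ}
    (hv : v ∈ Set.Icc 0 Real.pi) : ringRoot r s v ∈ Set.Icc (0 : ℝ) 1 := by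
  have h1 := coeffOne_pos hr hrs hs v
  have h2 := coeffTwo_nonneg hr hrs hs hv
  have hs0 : 0 < s := hr.trans hrs
  constructor
  · have : coeffTwo r s v ≤ √(ringDiscr r s v) :=
      Real.le_sqrt_of_sq_le (sq_coeffTwo_le_ringDiscr hr hrs hs v)
    exact div_nonneg (by linarith) (by linarith)
  -- `-c₃ ≤ Q² ≤ c₁`; together with `c₂ ≥ 0` this bounds the discriminant by `(2c₁ + c₂)²`.
  · have h3 : -coeffThree r s v ≤ coeffOne r s v := by
      rw [coeffOne_eq, coeffThree]
      have : (r * Real.sin v) ^ 2 * (1 - s ^ 2) ^ 2 ≤ (r * Real.sin v) ^ 2 * (1 + s ^ 2) ^ 2 :=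
        mul_le_mul_of_nonneg_left (by nlinarith [sq_nonneg s]) (sq_nonneg _)
      nlinarith [sq_nonneg (s * (1 + r ^ 2) - r * (1 + s ^ 2) * Real.cos v)]
    have : √(ringDiscr r s v) ≤ 2 * coeffOne r s v + coeffTwo r s v := by
      apply Real.sqrt_le_iff.2 ⟨by linarith, ?_⟩
      unfold ringDiscr
      nlinarith [mul_nonneg h1.le h2]
    rw [ringRoot, div_le_one (by linarith)]
    linarith

theorem sin_ringAngle (hr : 0 < r) (hrs : r < s) (hs : s < 1) {v : ℝ}
    (hv : v ∈ Set.Icc 0 Real.pi) : Real.sin (ringAngle r s v) = ringRoot r s v := by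
  have h := ringRoot_mem_Icc hr hrs hs hv
  exact Real.sin_arcsin (by linarith [h.1]) h.2

theorem ringAngle_nonneg (hr : 0 < r) (hrs : r < s) (hs : s < 1) {v : ℝ}
    (hv : v ∈ Set.Icc 0 Real.pi) : 0 ≤ ringAngle r s v :=
  Real.arcsin_nonneg.2 (ringRoot_mem_Icc hr hrs hs hv).1

theorem cos_ringAngle_nonneg (r s v : ℝ) : 0 ≤ Real.cos (ringAngle r s v) :=
  Real.cos_arcsin_nonneg _

/-- The angle `u(v)` is a critical point of `θ ↦ |e^{-θi} - r e^{vi}| / |e^{-θi} - s|`. -/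
theorem ringAngle_critical (hr : 0 < r) (hrs : r < s) (hs : s < 1) {v : ℝ}
    (hv : v ∈ Set.Icc 0 Real.pi) :
    r * (1 + s ^ 2) * Real.sin v * Real.cos (ringAngle r s v)
      = 2 * r * s * Real.sin v
        + (s * (1 + r ^ 2) - r * (1 + s ^ 2) * Real.cos v) * Real.sin (ringAngle r s v) := by
  have hs0 : 0 < s := hr.trans hrs
  have hP := ring_slope_pos hr hrs hs v
  have hv0 := Real.sin_nonneg_of_mem_Icc hv
  have hu := (ringRoot_mem_Icc hr hrs hs hv).1
  have hc := cos_ringAngle_nonneg r s v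
  have hq := ringRoot_quadratic hr hrs hs v
  rw [coeffOne_eq, coeffTwo, coeffThree] at hq
  rw [← sin_ringAngle hr hrs hs hv] at hu hq
  -- Both sides are nonnegative, so the squared equation, which is the quadratic, loses nothing.
  refine (pow_left_inj₀ (by positivity) (by positivity) two_ne_zero).1 ?_
  linear_combination (r * (1 + s ^ 2) * Real.sin v) ^ 2
    * Real.sin_sq_add_cos_sq (ringAngle r s v) - hq

/-- The angle `u(v)` maximizes `θ ↦ |e^{-θi} - r e^{vi}| / |e^{-θi} - s|`. -/
theorem ringAngle_optimal (hr : 0 < r) (hrs : r < s) (hs : s < 1) {v : ℝ}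
    (hv : v ∈ Set.Icc 0 Real.pi) (θ : ℝ) :
    (1 + r ^ 2 - 2 * r * Real.cos (θ + v)) * (1 + s ^ 2 - 2 * s * Real.cos (ringAngle r s v))
      ≤ (1 + r ^ 2 - 2 * r * Real.cos (ringAngle r s v + v))
        * (1 + s ^ 2 - 2 * s * Real.cos θ) := by
  have hcrit := ringAngle_critical hr hrs hs hv
  have hP := ring_slope_pos hr hrs hs v
  have hv0 := Real.sin_nonneg_of_mem_Icc hv
  have hu := (ringRoot_mem_Icc hr hrs hs hv).1
  have hc := cos_ringAngle_nonneg r s v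
  rw [← sin_ringAngle hr hrs hs hv] at hu
  set u := ringAngle r s v
  -- The difference of the two sides is a constant plus a combination of `cos θ` and `sin θ`, with a
  -- double zero at `θ = u`. Hence it is a multiple of `1 - cos (θ - u)`, and the factor `2(P cos u
  -- + Q sin u)` is nonnegative.
  have hkey : 0 ≤ 2 * ((s * (1 + r ^ 2) - r * (1 + s ^ 2) * Real.cos v) * Real.cos u
      + r * (1 + s ^ 2) * Real.sin v * Real.sin u) * (1 - Real.cos (θ - u)) :=
    mul_nonneg (by positivity) (by linarith [Real.cos_le_one (θ - u)])
  rw [Real.cos_sub] at hkey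
  rw [Real.cos_add, Real.cos_add]
  have hsc := Real.sin_sq_add_cos_sq u
  generalize Real.cos u = c at *
  generalize Real.sin u = d at *
  generalize Real.cos θ = C at *
  generalize Real.sin θ = D at *
  generalize Real.cos v = p at *
  generalize Real.sin v = q at *
  refine sub_nonneg.1 (hkey.trans_eq ?_)
  linear_combination (-2 * (s * (1 + r ^ 2) - r * (1 + s ^ 2) * p) * C
    - 2 * (r * (1 + s ^ 2) * q) * D) * hsc - (2 * d * C - 2 * c * D) * hcrit

/-- For `v > 0` the critical equation turns `r(1+s²) sin (u + v)` into a sum of nonnegative terms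
with a positive one. This keeps `u + v` where cosine still decreases, leaving room to increase `v`.
-/
theorem ringAngle_add_lt_pi (hr : 0 < r) (hrs : r < s) (hs : s < 1) {v : ℝ}
    (hv : v ∈ Set.Ico 0 Real.pi) : ringAngle r s v + v < Real.pi := by
  have hv' : v ∈ Set.Icc 0 Real.pi := Set.Ico_subset_Icc_self hv
  have hs0 : 0 < s := hr.trans hrs
  have hP := ring_slope_pos hr hrs hs v
  have hcrit := ringAngle_critical hr hrs hs hv'
  have hle : ringAngle r s v ≤ Real.pi / 2 := Real.arcsin_le_pi_div_two _
  rcases hv.1.eq_or_lt with rfl | h0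
  · linarith [Real.pi_pos]
  · have hsin := Real.sin_pos_of_pos_of_lt_pi h0 hv.2
    have hu := (ringRoot_mem_Icc hr hrs hs hv').1
    rw [← sin_ringAngle hr hrs hs hv'] at hu
    have hpos : 0 < r * (1 + s ^ 2) * Real.sin (ringAngle r s v + v) := by
      have : r * (1 + s ^ 2) * Real.sin (ringAngle r s v + v)
          = 2 * r * s * Real.sin v + s * (1 + r ^ 2) * Real.sin (ringAngle r s v) := by
        rw [Real.sin_add]
        linear_combination hcrit
      rw [this]
      positivity
    by_contra! hge
    have : Real.sin (ringAngle r s v + v) ≤ 0 := by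
      rw [← neg_nonneg, ← Real.sin_sub_pi]
      exact Real.sin_nonneg_of_nonneg_of_le_pi (by linarith) (by linarith [hv.2, Real.pi_pos])
    nlinarith [show 0 < r * (1 + s ^ 2) by positivity]

end RingAngle

/-! ### Maximizing the squared mixed quotient over both angles. -/

section MixedBoundary

variable {r s t μ : ℝ}

theorem exists_mixed_max (hr : 0 < r) (hr1 : r < 1) (hrs : r < s) (hs : s < 1) (hrt : r < t)
    (hμ : μ ∈ Set.Icc 0 Real.pi) :
    ∃ w ∈ Set.Icc μ Real.pi, ∀ θ v : ℝ,
      (1 + r ^ 2 - 2 * r * Real.cos (θ + v))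
          / ((1 + s ^ 2 - 2 * s * Real.cos θ) * (r ^ 2 + t ^ 2 - 2 * r * t * Real.cos (v - μ)))
        ≤ (1 + r ^ 2 - 2 * r * Real.cos (ringAngle r s w + w))
          / ((1 + s ^ 2 - 2 * s * Real.cos (ringAngle r s w))
            * (r ^ 2 + t ^ 2 - 2 * r * t * Real.cos (w - μ))) := by
  have hs0 : 0 < s := hr.trans hrs
  have ht0 : 0 < t := hr.trans hrt
  have hD : ∀ θ : ℝ, 0 < 1 + s ^ 2 - 2 * s * Real.cos θ := fun θ => by
    nlinarith [Real.cos_le_one θ, mul_pos (sub_pos.2 hs) (sub_pos.2 hs)]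
  have hE : ∀ φ : ℝ, 0 < r ^ 2 + t ^ 2 - 2 * r * t * Real.cos φ := fun φ => by
    nlinarith [Real.cos_le_one φ, mul_pos (sub_pos.2 hrt) (sub_pos.2 hrt), mul_pos hr ht0]
  have hN : ∀ φ : ℝ, 0 < 1 + r ^ 2 - 2 * r * Real.cos φ := fun φ => by
    nlinarith [Real.cos_le_one φ, mul_pos (sub_pos.2 hr1) (sub_pos.2 hr1)]
  set g : ℝ → ℝ → ℝ := fun θ v => (1 + r ^ 2 - 2 * r * Real.cos (θ + v))
          / ((1 + s ^ 2 - 2 * s * Real.cos θ) * (r ^ 2 + t ^ 2 - 2 * r * t * Real.cos (v - μ)))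
    with hg
  have hcont : Continuous (fun p : ℝ × ℝ => g p.1 p.2) := by
    refine Continuous.div (by fun_prop) (by fun_prop) fun p => ?_
    exact (mul_pos (hD _) (hE _)).ne'
  obtain ⟨⟨θ₀, v₀⟩, ⟨-, hv₀⟩, hmax⟩ := ((isCompact_Icc (a := (0 : ℝ)) (b := 2 * Real.pi)).prod
    (isCompact_Icc (a := (0 : ℝ)) (b := 2 * Real.pi))).exists_isMaxOn
    ⟨(0, 0), by simp [Real.pi_pos.le]⟩ hcont.continuousOn
  have hper₁ : ∀ v, Function.Periodic (fun θ => g θ v) (2 * Real.pi) := fun v θ => by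
    simp only [hg]
    rw [show θ + 2 * Real.pi + v = θ + v + 2 * Real.pi by ring, Real.cos_add_two_pi,
      Real.cos_add_two_pi]
  have hper₂ : ∀ θ, Function.Periodic (fun v => g θ v) (2 * Real.pi) := fun θ v => by
    simp only [hg]
    rw [show θ + (v + 2 * Real.pi) = θ + v + 2 * Real.pi by ring,
      show v + 2 * Real.pi - μ = v - μ + 2 * Real.pi by ring, Real.cos_add_two_pi,
      Real.cos_add_two_pi]
  have hglob : ∀ θ v, g θ v ≤ g θ₀ v₀ := fun θ v => by
    obtain ⟨θ', hθ', h1⟩ := (hper₁ v).exists_mem_Ico₀ Real.two_pi_pos θ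
    obtain ⟨v', hv', h2⟩ := (hper₂ θ').exists_mem_Ico₀ Real.two_pi_pos v
    exact (h1.trans h2).le.trans
      (hmax (a := (θ', v')) ⟨Set.Ico_subset_Icc_self hθ', Set.Ico_subset_Icc_self hv'⟩)
  -- Conjugating both boundary points fixes `s` and brings a lower inner point to the upper half
  -- plane, no farther from `t e^{μi}`.
  obtain ⟨θ₁, w, hw, hle⟩ : ∃ θ₁ w, w ∈ Set.Icc 0 Real.pi ∧ g θ₀ v₀ ≤ g θ₁ w := by
    rcases le_total v₀ Real.pi with h | h
    · exact ⟨θ₀, v₀, ⟨hv₀.1, h⟩, le_rfl⟩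
    · refine ⟨-θ₀, 2 * Real.pi - v₀, ⟨by linarith [hv₀.2], by linarith⟩, ?_⟩
      simp only [hg]
      rw [show -θ₀ + (2 * Real.pi - v₀) = 2 * Real.pi - (θ₀ + v₀) by ring, Real.cos_two_pi_sub,
        Real.cos_neg, show 2 * Real.pi - v₀ - μ = 2 * Real.pi - (v₀ + μ) by ring,
        Real.cos_two_pi_sub]
      have hsv : Real.sin v₀ ≤ 0 := by
        have := Real.sin_nonneg_of_mem_Icc (x := 2 * Real.pi - v₀)
          ⟨by linarith [hv₀.2], by linarith⟩
        rw [Real.sin_two_pi_sub] at this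
        linarith
      have hcos : Real.cos (v₀ - μ) ≤ Real.cos (v₀ + μ) := by
        rw [Real.cos_add, Real.cos_sub]
        nlinarith [Real.sin_nonneg_of_mem_Icc hμ]
      have := hE (v₀ + μ)
      have := hD θ₀
      have := hN (θ₀ + v₀)
      gcongr
  have hopt : ∀ θ, g θ w ≤ g (ringAngle r s w) w := fun θ => by
    simp only [hg]
    rw [div_le_div_iff₀ (mul_pos (hD _) (hE _)) (mul_pos (hD _) (hE _))]
    nlinarith [mul_le_mul_of_nonneg_right (ringAngle_optimal hr hrs hs hw θ) (hE (w - μ)).le]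
  have hall : ∀ θ v, g θ v ≤ g (ringAngle r s w) w := fun θ v =>
    (hglob θ v).trans (hle.trans (hopt θ₁))
  refine ⟨w, ⟨?_, hw.2⟩, hall⟩
  by_contra! hlt
  set u := ringAngle r s w
  have hu0 : 0 ≤ u := ringAngle_nonneg hr hrs hs hw
  have huw : u + w < Real.pi := ringAngle_add_lt_pi hr hrs hs ⟨hw.1, hlt.trans_le hμ.2⟩
  -- If `w < μ`, rotating the inner point up to this angle strictly increases its distance to
  -- `e^{-ui}` (until `u + v = π`) without moving it away from `t e^{μi}` (until `v = μ`),
  -- contradicting maximality.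
  have hw' : w < min μ (Real.pi - u) := lt_min hlt (by linarith)
  have h1 : Real.cos (u + min μ (Real.pi - u)) < Real.cos (u + w) :=
    Real.cos_lt_cos_of_nonneg_of_le_pi (by linarith [hw.1])
      (by linarith [min_le_right μ (Real.pi - u)]) (by linarith)
  have h2 : Real.cos (w - μ) ≤ Real.cos (min μ (Real.pi - u) - μ) := by
    rw [← Real.cos_neg (w - μ), ← Real.cos_neg (min μ (Real.pi - u) - μ)]
    exact Real.cos_le_cos_of_nonneg_of_le_pi (by linarith [min_le_left μ (Real.pi - u)])
      (by linarith [hμ.2, hw.1]) (by linarith)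
  refine (hall u (min μ (Real.pi - u))).not_gt ?_
  simp only [hg]
  have := hE (min μ (Real.pi - u) - μ)
  have := hD u
  have := hN (u + w)
  exact div_lt_div₀ (by gcongr) (by gcongr) (hN _).le (by positivity)

/-- Exchanging the moduli of the two points increases the mixed product of distances. -/
theorem mixed_prod_le (hr : 0 < r) (hr1 : r < 1) (hrt : r < t) (hts : t ≤ s) (hs : s < 1)
    (α β : ℝ) :
    (1 + s ^ 2 - 2 * s * Real.cos α) * (r ^ 2 + t ^ 2 - 2 * r * t * Real.cos β)
      ≤ (1 + t ^ 2 - 2 * t * Real.cos α) * (r ^ 2 + s ^ 2 - 2 * r * s * Real.cos β) := by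
  have hst : r ^ 2 ≤ s * t := by nlinarith
  have h1 : (s * t - r ^ 2) * Real.cos α ≤ (s * t - r ^ 2) * 1 :=
    mul_le_mul_of_nonneg_left (Real.cos_le_one α) (by linarith)
  have h2 : r * (1 - s * t) * Real.cos β ≤ r * (1 - s * t) * 1 :=
    mul_le_mul_of_nonneg_left (Real.cos_le_one β) (mul_nonneg hr.le (by nlinarith))
  -- The difference of the two sides is `s - t` times a bracket that is smallest when both cosines
  -- equal 1; this is that smallest value, factored.
  have h3 : 0 ≤ (1 - r) * ((s - r) * (1 - t) + (t - r) * (1 - s)) := by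
    have : 0 ≤ (s - r) * (1 - t) := mul_nonneg (by linarith) (by linarith)
    have : 0 ≤ (t - r) * (1 - s) := mul_nonneg (by linarith) (by linarith)
    exact mul_nonneg (by linarith) (by linarith)
  have h4 : 0 ≤ (s - t) * ((s + t) * (1 - r ^ 2) + 2 * Real.cos α * (r ^ 2 - s * t)
      - 2 * r * Real.cos β * (1 - s * t)) :=
    mul_nonneg (by linarith) (by linarith)
  linarith

end MixedBoundary

/-! ### Cross-ratios with one boundary point on each circle. -/

section MixedCrossRatio

theorem norm_polar_sub_polar_sq (a b α β : ℝ) :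
    ‖(a : ℂ) * Complex.exp (α * Complex.I) - b * Complex.exp (β * Complex.I)‖ ^ 2
      = a ^ 2 + b ^ 2 - 2 * a * b * Real.cos (α - β) := by
  rw [Complex.sq_norm, Complex.normSq_apply, Real.cos_sub]
  simp only [Complex.sub_re, Complex.sub_im, Complex.re_ofReal_mul, Complex.im_ofReal_mul,
    Complex.exp_ofReal_mul_I_re, Complex.exp_ofReal_mul_I_im]
  linear_combination a ^ 2 * Real.sin_sq_add_cos_sq α + b ^ 2 * Real.sin_sq_add_cos_sq β

theorem exists_eq_polar {z : ℂ} {a : ℝ} (h : ‖z‖ = a) :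
    ∃ θ : ℝ, z = a * Complex.exp (θ * Complex.I) :=
  ⟨Complex.arg z, by rw [← h, Complex.norm_mul_exp_arg_mul_I]⟩

theorem absCrossRatio_coe_eq_mul (a x b y : ℂ) :
    absCrossRatio (a : OnePoint ℂ) (x : OnePoint ℂ) (b : OnePoint ℂ) (y : OnePoint ℂ)
      = ‖x - y‖ * (‖a - b‖ / (‖a - x‖ * ‖b - y‖)) := by
  rw [absCrossRatio_coe]
  ring

theorem absCrossRatio_map {f : ℂ → ℂ} (hf : Isometry f) (a x b y : ℂ) :
    absCrossRatio (f a : OnePoint ℂ) (f x : OnePoint ℂ) (f b : OnePoint ℂ) (f y : OnePoint ℂ)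
      = absCrossRatio (a : OnePoint ℂ) (x : OnePoint ℂ) (b : OnePoint ℂ) (y : OnePoint ℂ) := by
  simp only [absCrossRatio_coe, ← dist_eq_norm, hf.dist_eq]

theorem mixed_quotient_sq (r s t μ θ v : ℝ) :
    (‖Complex.exp (-(θ : ℂ) * Complex.I) - r * Complex.exp (v * Complex.I)‖
      / (‖Complex.exp (-(θ : ℂ) * Complex.I) - s‖
        * ‖(r : ℂ) * Complex.exp (v * Complex.I) - t * Complex.exp (μ * Complex.I)‖)) ^ 2
      = (1 + r ^ 2 - 2 * r * Real.cos (θ + v))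
          / ((1 + s ^ 2 - 2 * s * Real.cos θ)
            * (r ^ 2 + t ^ 2 - 2 * r * t * Real.cos (v - μ))) := by
  have h1 := norm_polar_sub_polar_sq 1 r (-θ) v
  have h2 := norm_polar_sub_polar_sq 1 s (-θ) 0
  rw [← neg_add', Real.cos_neg] at h1
  rw [sub_zero, Real.cos_neg] at h2
  simp only [Complex.ofReal_one, one_mul, Complex.ofReal_neg, Complex.ofReal_zero, zero_mul,
    Complex.exp_zero, mul_one, one_pow] at h1 h2
  rw [div_pow, mul_pow, h1, h2, norm_polar_sub_polar_sq]

variable {r s t μ : ℝ}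

theorem exists_outer_inner_max (hr : 0 < r) (hr1 : r < 1) (hrs : r < s) (hs : s < 1)
    (hrt : r < t) (hμ : μ ∈ Set.Icc 0 Real.pi) :
    ∃ w ∈ Set.Icc μ Real.pi, ∀ a b : ℂ, ‖a‖ = 1 → ‖b‖ = r →
      absCrossRatio (a : OnePoint ℂ) ((s : ℂ) : OnePoint ℂ) (b : OnePoint ℂ)
          ((t : ℂ) * Complex.exp ((μ : ℂ) * Complex.I) : ℂ)
        ≤ absCrossRatio (Complex.exp (-(ringAngle r s w : ℂ) * Complex.I) : ℂ)
          ((s : ℂ) : OnePoint ℂ) ((r : ℂ) * Complex.exp ((w : ℂ) * Complex.I) : ℂ)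
          ((t : ℂ) * Complex.exp ((μ : ℂ) * Complex.I) : ℂ) := by
  obtain ⟨w, hw, hmax⟩ := exists_mixed_max hr hr1 hrs hs hrt hμ
  refine ⟨w, hw, fun a b ha hb => ?_⟩
  obtain ⟨θ, rfl⟩ := exists_eq_polar ha
  obtain ⟨v, rfl⟩ := exists_eq_polar hb
  rw [absCrossRatio_coe_eq_mul, absCrossRatio_coe_eq_mul]
  refine mul_le_mul_of_nonneg_left ?_ (norm_nonneg _)
  refine (pow_le_pow_iff_left₀ (by positivity) (by positivity) two_ne_zero).1 ?_
  rw [mixed_quotient_sq]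
  refine le_of_eq_of_le ?_ (hmax (-θ) v)
  rw [← mixed_quotient_sq]
  simp

/-- The isometry `z ↦ e^{μi} z̄` exchanges the directions of the two points. -/
theorem inner_outer_le_outer_inner (hr : 0 < r) (hr1 : r < 1) (hrt : r < t) (hts : t ≤ s)
    (hs : s < 1) {a b : ℂ} (ha : ‖a‖ = r) (hb : ‖b‖ = 1) :
    absCrossRatio (a : OnePoint ℂ) ((s : ℂ) : OnePoint ℂ) (b : OnePoint ℂ)
          ((t : ℂ) * Complex.exp ((μ : ℂ) * Complex.I) : ℂ)
      ≤ absCrossRatio (Complex.exp (μ * Complex.I) * conj b : ℂ) ((s : ℂ) : OnePoint ℂ)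
          (Complex.exp (μ * Complex.I) * conj a : ℂ)
          ((t : ℂ) * Complex.exp ((μ : ℂ) * Complex.I) : ℂ) := by
  obtain ⟨α, rfl⟩ := exists_eq_polar ha
  obtain ⟨β, rfl⟩ := exists_eq_polar hb
  have hrefl : ∀ ρ θ : ℝ, Complex.exp (μ * Complex.I) * conj (ρ * Complex.exp (θ * Complex.I))
      = ρ * Complex.exp (((μ - θ : ℝ) : ℂ) * Complex.I) := fun ρ θ => by
    rw [map_mul, Complex.conj_ofReal, ← Complex.exp_conj, map_mul, Complex.conj_ofReal,
      Complex.conj_I, mul_left_comm, ← Complex.exp_add]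
    push_cast
    ring_nf
  rw [hrefl, hrefl, absCrossRatio_coe_eq_mul, absCrossRatio_coe_eq_mul]
  refine mul_le_mul_of_nonneg_left ?_ (norm_nonneg _)
  refine (pow_le_pow_iff_left₀ (by positivity) (by positivity) two_ne_zero).1 ?_
  have h2 : ∀ ρ θ : ℝ, ‖(ρ : ℂ) * Complex.exp (θ * Complex.I) - s‖ ^ 2
      = ρ ^ 2 + s ^ 2 - 2 * ρ * s * Real.cos θ := fun ρ θ => by
    simpa using norm_polar_sub_polar_sq ρ s θ 0
  simp only [div_pow, mul_pow, norm_polar_sub_polar_sq, h2]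
  have hs0 : 0 < s := by linarith
  have ht0 : 0 < t := by linarith
  have hD : 0 < 1 ^ 2 + s ^ 2 - 2 * 1 * s * Real.cos (μ - β) := by
    nlinarith [Real.cos_le_one (μ - β), mul_pos (sub_pos.2 hs) (sub_pos.2 hs)]
  have hE : 0 < r ^ 2 + t ^ 2 - 2 * r * t * Real.cos (μ - α - μ) := by
    nlinarith [Real.cos_le_one (μ - α - μ), mul_pos (sub_pos.2 hrt) (sub_pos.2 hrt),
      mul_pos hr ht0]
  rw [show (1 : ℝ) ^ 2 + r ^ 2 - 2 * 1 * r * Real.cos (μ - β - (μ - α))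
      = r ^ 2 + 1 ^ 2 - 2 * r * 1 * Real.cos (α - β) by
    rw [show μ - β - (μ - α) = α - β by ring]
    ring]
  -- The numerators now agree, and the denominators differ only by exchanging `s` and `t`.
  refine div_le_div_of_nonneg_left ?_ (mul_pos hD hE) ?_
  · rw [← norm_polar_sub_polar_sq]
    positivity
  · have := mixed_prod_le hr hr1 hrt hts hs (μ - β) (μ - α - μ)
    have e1 : Real.cos (μ - α - μ) = Real.cos α := by
      rw [sub_sub_cancel_left, Real.cos_neg]
    have e2 : Real.cos (β - μ) = Real.cos (μ - β) := by
      rw [← Real.cos_neg, neg_sub]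
    rw [e1] at this ⊢
    rw [e2]
    linarith

end MixedCrossRatio

/-! ### The Möbius metric of the disk is the hyperbolic metric. -/

section Disk

variable {x y : ℂ}

theorem norm_one_sub_conj_mul_sq (x y : ℂ) :
    ‖1 - conj x * y‖ ^ 2 = ‖x - y‖ ^ 2 + (1 - ‖x‖ ^ 2) * (1 - ‖y‖ ^ 2) := by
  simp only [Complex.sq_norm, Complex.normSq_apply, Complex.sub_re, Complex.sub_im,
    Complex.mul_re, Complex.mul_im, Complex.conj_re, Complex.conj_im, Complex.one_re,
    Complex.one_im]
  ring

theorem norm_one_sub_conj_mul_of_norm_one {a : ℂ} (x : ℂ) (ha : ‖a‖ = 1) :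
    ‖1 - conj x * a‖ = ‖a - x‖ := by
  refine (pow_left_inj₀ (norm_nonneg _) (norm_nonneg _) two_ne_zero).1 ?_
  rw [norm_one_sub_conj_mul_sq, ha, norm_sub_rev]
  ring

theorem one_sub_norm_sq_pos (hx : ‖x‖ < 1) : 0 < 1 - ‖x‖ ^ 2 := by
  nlinarith [norm_nonneg x]

theorem norm_sub_lt_norm_one_sub_conj_mul (hx : ‖x‖ < 1) (hy : ‖y‖ < 1) :
    ‖x - y‖ < ‖1 - conj x * y‖ := by
  refine lt_of_pow_lt_pow_left₀ 2 (norm_nonneg _) ?_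
  rw [norm_one_sub_conj_mul_sq]
  linarith [mul_pos (one_sub_norm_sq_pos hx) (one_sub_norm_sq_pos hy)]

/-- With `A = |x - y|` and `B = |1 - conj x * y|`, `sinh (ρ/2)` and `cosh (ρ/2)` are `A/√C` and
`B/√C` where `C = B² - A²`, so `e^ρ = (B + A)/(B - A)`. -/
theorem diskHypDist_eq_log (hx : ‖x‖ < 1) (hy : ‖y‖ < 1) :
    diskHypDist x y
      = Real.log (1 + ‖x - y‖ * (2 / (‖1 - conj x * y‖ - ‖x - y‖))) := by
  have hB := norm_one_sub_conj_mul_sq x y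
  have hC := mul_pos (one_sub_norm_sq_pos hx) (one_sub_norm_sq_pos hy)
  have hAB := norm_sub_lt_norm_one_sub_conj_mul hx hy
  unfold diskHypDist
  set C := (1 - ‖x‖ ^ 2) * (1 - ‖y‖ ^ 2)
  set A := ‖x - y‖
  set B := ‖1 - conj x * y‖
  have hA0 : 0 ≤ A := norm_nonneg _
  have hsC := Real.sqrt_pos.2 hC
  have hC2 : √C ^ 2 = C := Real.sq_sqrt hC.le
  have h1 : √(1 + (A / √C) ^ 2) = B / √C := by
    rw [← Real.sqrt_sq (show 0 ≤ B / √C by positivity)]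
    congr 1
    rw [div_pow, div_pow, hC2, hB]
    field_simp
    ring
  have hsub : B - A ≠ 0 := by linarith
  rw [Real.arsinh, h1, ← Nat.cast_ofNat (R := ℝ) (n := 2), ← Real.log_pow]
  congr 1
  rw [← add_div, div_pow, hC2, show C = (B - A) * (B + A) by linear_combination -hB]
  have : B + A ≠ 0 := by linarith
  field_simp
  ring

/-- Let `T z = (z - x)/(1 - conj x * z)`, which sends `x` to 0. The two bounds are `|T a - T b| ≤ 2`
and `|T b - T y| ≥ 1 - |T y|`, cleared of denominators. -/
theorem disk_quotient_le (hx : ‖x‖ < 1) (hy : ‖y‖ < 1) {a b : ℂ} (ha : ‖a‖ = 1)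
    (hb : ‖b‖ = 1) :
    ‖a - b‖ / (‖a - x‖ * ‖b - y‖) ≤ 2 / (‖1 - conj x * y‖ - ‖x - y‖) := by
  have hx2 := one_sub_norm_sq_pos hx
  have hAB := norm_sub_lt_norm_one_sub_conj_mul hx hy
  have hxx : conj x * x = ((‖x‖ ^ 2 : ℝ) : ℂ) := by
    rw [mul_comm, Complex.mul_conj, Complex.normSq_eq_norm_sq]
  have hnorm : ∀ z : ℂ, ‖((1 - ‖x‖ ^ 2 : ℝ) : ℂ) * z‖ = (1 - ‖x‖ ^ 2) * ‖z‖ := fun z => by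
    rw [norm_mul, Complex.norm_of_nonneg hx2.le]
  have h1 : (1 - ‖x‖ ^ 2) * ‖a - b‖ ≤ 2 * (‖a - x‖ * ‖b - x‖) := by
    rw [← hnorm, show ((1 - ‖x‖ ^ 2 : ℝ) : ℂ) * (a - b)
        = (a - x) * (1 - conj x * b) - (b - x) * (1 - conj x * a) by
      rw [Complex.ofReal_sub, Complex.ofReal_one, ← hxx]; ring]
    refine (norm_sub_le _ _).trans_eq ?_
    rw [norm_mul, norm_mul, norm_one_sub_conj_mul_of_norm_one x ha,
      norm_one_sub_conj_mul_of_norm_one x hb]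
    ring
  have h2 : ‖b - x‖ * (‖1 - conj x * y‖ - ‖x - y‖) ≤ (1 - ‖x‖ ^ 2) * ‖b - y‖ := by
    rw [← hnorm, show ((1 - ‖x‖ ^ 2 : ℝ) : ℂ) * (b - y)
        = (b - x) * (1 - conj x * y) - (y - x) * (1 - conj x * b) by
      rw [Complex.ofReal_sub, Complex.ofReal_one, ← hxx]; ring]
    refine le_of_eq_of_le ?_ (norm_sub_norm_le _ _)
    rw [norm_mul, norm_mul, norm_one_sub_conj_mul_of_norm_one x hb, norm_sub_rev y x]
    ring
  have hpos : ∀ {c z : ℂ}, ‖c‖ = 1 → ‖z‖ < 1 → 0 < ‖c - z‖ := fun {c z} hc hz =>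
    norm_sub_pos_iff.2 fun h => by rw [h] at hc; linarith
  rw [div_le_div_iff₀ (mul_pos (hpos ha hx) (hpos hb hy)) (by linarith)]
  refine le_of_mul_le_mul_left ?_ hx2
  have h3 := mul_le_mul_of_nonneg_right h1 (sub_pos.2 hAB).le
  have h4 := mul_le_mul_of_nonneg_left h2 (mul_nonneg zero_le_two (norm_nonneg (a - x)))
  linarith

theorem exists_disk_quotient_eq (hx : ‖x‖ < 1) (hy : ‖y‖ < 1) (hxy : x ≠ y) :
    ∃ a b : ℂ, ‖a‖ = 1 ∧ ‖b‖ = 1 ∧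
      ‖a - b‖ / (‖a - x‖ * ‖b - y‖) = 2 / (‖1 - conj x * y‖ - ‖x - y‖) := by
  have hx2 := one_sub_norm_sq_pos hx
  have hAB := norm_sub_lt_norm_one_sub_conj_mul hx hy
  have hA : 0 < ‖x - y‖ := norm_sub_pos_iff.2 hxy
  have hB : 0 < ‖1 - conj x * y‖ := hA.trans hAB
  have hB0 : 1 - conj x * y ≠ 0 := norm_pos_iff.1 hB
  have hA' : (‖x - y‖ : ℂ) ≠ 0 := by exact_mod_cast hA.ne'
  have hxx : conj x * x = ((‖x‖ ^ 2 : ℝ) : ℂ) := by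
    rw [mul_comm, Complex.mul_conj, Complex.normSq_eq_norm_sq]
  obtain ⟨w, hw, hwy⟩ : ∃ w : ℂ, ‖w‖ = 1 ∧ ‖w * (1 - conj x * y) - (y - x)‖
      = ‖1 - conj x * y‖ - ‖x - y‖ := by
    -- `w = T y / |T y|`, with `T` the disk automorphism sending `x` to 0: the unit point nearest to
    -- `T y`.
    refine ⟨(y - x) * ‖1 - conj x * y‖ / ((1 - conj x * y) * ‖x - y‖), ?_, ?_⟩
    · rw [norm_div, norm_mul, norm_mul, Complex.norm_real, Complex.norm_real, norm_norm,
        norm_norm, norm_sub_rev y x, mul_comm, div_self (by positivity)]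
    · rw [show (y - x) * ‖1 - conj x * y‖ / ((1 - conj x * y) * ‖x - y‖) * (1 - conj x * y)
          - (y - x) = (y - x) * (((‖1 - conj x * y‖ - ‖x - y‖) / ‖x - y‖ : ℝ) : ℂ) by
        generalize 1 - conj x * y = k at hB0
        push_cast
        field_simp]
      rw [norm_mul, Complex.norm_of_nonneg (div_nonneg (by linarith) hA.le), norm_sub_rev y x]
      field_simp
  have hne : ∀ {c : ℂ}, ‖c‖ = 1 → 0 < ‖1 + conj x * c‖ := fun {c} hc => by
    refine norm_pos_iff.2 fun h => ?_
    have : ‖conj x * c‖ = 1 := by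
      rw [eq_neg_of_add_eq_zero_right h]; simp
    rw [norm_mul, Complex.norm_conj, hc] at this
    linarith
  have hunit : ∀ {c : ℂ}, ‖c‖ = 1 → ‖(c + x) / (1 + conj x * c)‖ = 1 := fun {c} hc => by
    have h := norm_one_sub_conj_mul_of_norm_one (-x) hc
    rw [map_neg, neg_mul, sub_neg_eq_add, sub_neg_eq_add] at h
    rw [norm_div, ← h, div_self (hne hc).ne']
  have hw' : ‖-w‖ = 1 := by rwa [norm_neg]
  have h1 := hne hw
  have h2 := hne hw'
  have h1' := norm_pos_iff.1 h1
  have h2' := norm_pos_iff.1 h2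
  -- Preimages under `T` of the antipodal pair `-w`, `w`, for which both bounds are equalities.
  refine ⟨(-w + x) / (1 + conj x * -w), (w + x) / (1 + conj x * w), hunit hw', hunit hw, ?_⟩
  have e1 : (-w + x) / (1 + conj x * -w) - (w + x) / (1 + conj x * w)
      = -2 * w * ((1 - ‖x‖ ^ 2 : ℝ) : ℂ) / ((1 + conj x * -w) * (1 + conj x * w)) := by
    rw [div_sub_div _ _ h2' h1', Complex.ofReal_sub, Complex.ofReal_one, ← hxx]
    ring
  have e2 : (-w + x) / (1 + conj x * -w) - x
      = -w * ((1 - ‖x‖ ^ 2 : ℝ) : ℂ) / (1 + conj x * -w) := by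
    rw [div_sub' h2', Complex.ofReal_sub, Complex.ofReal_one, ← hxx]
    ring
  have e3 : (w + x) / (1 + conj x * w) - y
      = (w * (1 - conj x * y) - (y - x)) / (1 + conj x * w) := by
    rw [div_sub' h1']
    ring
  rw [e1, e2, e3]
  simp only [norm_div, norm_mul, hwy, hw', hw, Complex.norm_of_nonneg hx2.le, norm_neg,
    Complex.norm_ofNat]
  have : ‖1 - conj x * y‖ - ‖x - y‖ ≠ 0 := by linarith
  generalize ‖1 + conj x * -w‖ = k at h2
  field_simp

theorem log_absCrossRatio_le_diskHypDist (hx : ‖x‖ < 1) (hy : ‖y‖ < 1) {a b : ℂ}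
    (ha : ‖a‖ = 1) (hb : ‖b‖ = 1) :
    Real.log (1 + absCrossRatio (a : OnePoint ℂ) (x : OnePoint ℂ) (b : OnePoint ℂ)
      (y : OnePoint ℂ)) ≤ diskHypDist x y := by
  rw [diskHypDist_eq_log hx hy, absCrossRatio_coe_eq_mul]
  have := disk_quotient_le hx hy ha hb
  refine Real.log_le_log (by positivity) ?_
  gcongr

theorem exists_log_absCrossRatio_eq_diskHypDist (hx : ‖x‖ < 1) (hy : ‖y‖ < 1) :
    ∃ a b : ℂ, ‖a‖ = 1 ∧ ‖b‖ = 1 ∧ Real.log (1 + absCrossRatio (a : OnePoint ℂ)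
      (x : OnePoint ℂ) (b : OnePoint ℂ) (y : OnePoint ℂ)) = diskHypDist x y := by
  rcases eq_or_ne x y with rfl | hxy
  · exact ⟨1, 1, norm_one, norm_one, by simp [absCrossRatio_coe, diskHypDist]⟩
  · obtain ⟨a, b, ha, hb, h⟩ := exists_disk_quotient_eq hx hy hxy
    exact ⟨a, b, ha, hb, by rw [absCrossRatio_coe_eq_mul, h, diskHypDist_eq_log hx hy]⟩

end Disk

/-! ### Reflection exchanging the two boundary circles. -/

section Reflection

variable {r : ℝ}

/-- Reflection in the circle `|z| = √r`. -/
theorem ringReflection_eq (r : ℝ) (z : ℂ) :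
    (r : ℂ) * z / (‖z‖ : ℂ) ^ 2 = r / conj z := by
  rcases eq_or_ne z 0 with rfl | hz
  · simp
  · rw [← Complex.mul_conj']
    have : conj z ≠ 0 := by simpa using hz
    field_simp

theorem ringReflection_ringReflection (hr : r ≠ 0) (z : ℂ) :
    (r : ℂ) / conj ((r : ℂ) / conj z) = z := by
  have : (r : ℂ) ≠ 0 := by exact_mod_cast hr
  rw [map_div₀, Complex.conj_ofReal, Complex.conj_conj]
  field_simp

theorem norm_ringReflection (hr : 0 < r) (z : ℂ) : ‖(r : ℂ) / conj z‖ = r / ‖z‖ := by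
  rw [norm_div, Complex.norm_of_nonneg hr.le, Complex.norm_conj]

theorem norm_ringReflection_sub (hr : 0 < r) {z w : ℂ} (hz : z ≠ 0) (hw : w ≠ 0) :
    ‖(r : ℂ) / conj z - r / conj w‖ = r * ‖z - w‖ / (‖z‖ * ‖w‖) := by
  rw [div_sub_div _ _ (by simpa using hz) (by simpa using hw), norm_div, norm_mul,
    Complex.norm_conj, Complex.norm_conj, ← mul_comm (r : ℂ), ← mul_sub, norm_mul,
    Complex.norm_of_nonneg hr.le, ← map_sub, Complex.norm_conj, norm_sub_rev]

/-- Each distance `|z - w|` is scaled by `r / (|z||w|)`, and every point occurs once in the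
numerator and once in the denominator. -/
theorem absCrossRatio_ringReflection (hr : 0 < r) {a x b y : ℂ} (ha : a ≠ 0) (hx : x ≠ 0)
    (hb : b ≠ 0) (hy : y ≠ 0) :
    absCrossRatio ((r : ℂ) / conj a : ℂ) ((r : ℂ) / conj x : ℂ) ((r : ℂ) / conj b : ℂ)
        ((r : ℂ) / conj y : ℂ)
      = absCrossRatio (a : OnePoint ℂ) (x : OnePoint ℂ) (b : OnePoint ℂ) (y : OnePoint ℂ) := by
  rw [absCrossRatio_coe, absCrossRatio_coe, norm_ringReflection_sub hr ha hb,
    norm_ringReflection_sub hr hx hy, norm_ringReflection_sub hr ha hx,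
    norm_ringReflection_sub hr hb hy]
  have ha' := norm_pos_iff.2 ha
  have hx' := norm_pos_iff.2 hx
  have hb' := norm_pos_iff.2 hb
  have hy' := norm_pos_iff.2 hy
  rw [div_mul_div_comm, div_mul_div_comm,
    show ‖a‖ * ‖b‖ * (‖x‖ * ‖y‖) = ‖a‖ * ‖x‖ * (‖b‖ * ‖y‖) by ring,
    div_div_div_cancel_right₀ (by positivity), mul_mul_mul_comm, mul_mul_mul_comm r ‖a - x‖,
    mul_div_mul_left _ _ (by positivity)]

end Reflection

/-! ### The boundary of the ring in the extended plane. -/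

section Boundary

variable {r : ℝ}

theorem isOpen_annularRing (r : ℝ) : IsOpen (annularRing r) :=
  (isOpen_lt continuous_const continuous_norm).inter (isOpen_lt continuous_norm continuous_const)

theorem closure_annularRing (hr : 0 < r) (hr1 : r < 1) :
    closure (annularRing r) = {z : ℂ | r ≤ ‖z‖ ∧ ‖z‖ ≤ 1} := by
  apply Set.Subset.antisymm
  · refine closure_minimal (fun z hz => ⟨hz.1.le, hz.2.le⟩) ?_
    exact (isClosed_le continuous_const continuous_norm).inter
      (isClosed_le continuous_norm continuous_const)
  · rintro z ⟨h1, h2⟩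
    have hz : 0 < ‖z‖ := hr.trans_le h1
    have hlt : r / ‖z‖ < 1 / ‖z‖ := by gcongr
    -- Radial approach: `t * z` lies in the ring exactly for positive `t` in this interval.
    have hmem : (1 : ℝ) ∈ closure (Set.Ioo (r / ‖z‖) (1 / ‖z‖)) := by
      rw [closure_Ioo hlt.ne]
      exact ⟨(div_le_one hz).2 h1, (one_le_div hz).2 h2⟩
    have := map_mem_closure (f := fun t : ℝ => (t : ℂ) * z) (t := annularRing r)
      (by fun_prop) hmem (fun t ht => ?_)
    · simpa using this
    · have ht0 : 0 < t := lt_trans (by positivity) ht.1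
      have e : ‖(t : ℂ) * z‖ = t * ‖z‖ := by
        rw [norm_mul, Complex.norm_of_nonneg ht0.le]
      exact ⟨by rw [e]; exact (div_lt_iff₀ hz).1 ht.1, by rw [e]; exact (lt_div_iff₀ hz).1 ht.2⟩

theorem frontier_annularRing (hr : 0 < r) (hr1 : r < 1) :
    frontier (annularRing r) = {z : ℂ | ‖z‖ = r ∨ ‖z‖ = 1} := by
  rw [(isOpen_annularRing r).frontier_eq, closure_annularRing hr hr1]
  ext z
  simp only [annularRing, Set.mem_sdiff, Set.mem_ofPred_eq]
  constructor
  · rintro ⟨⟨h1, h2⟩, h3⟩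
    rcases h1.eq_or_lt with h | h
    · exact Or.inl h.symm
    · exact Or.inr (h2.antisymm (not_lt.1 fun h' => h3 ⟨h, h'⟩))
  · rintro (h | h)
    · exact ⟨⟨h.ge, by linarith⟩, fun h' => by linarith [h'.1]⟩
    · exact ⟨⟨by linarith, h.le⟩, fun h' => by linarith [h'.2]⟩

/-- The closed ring is compact, so its image is already closed and `∞` is not a boundary point. -/
theorem frontier_image_annularRing (hr : 0 < r) (hr1 : r < 1) :
    frontier ((fun z : ℂ => (z : OnePoint ℂ)) '' annularRing r)
      = (fun z : ℂ => (z : OnePoint ℂ)) '' {z : ℂ | ‖z‖ = r ∨ ‖z‖ = 1} := by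
  have hemb : Topology.IsOpenEmbedding (fun z : ℂ => (z : OnePoint ℂ)) :=
    OnePoint.isOpenEmbedding_coe
  have hcl : closure ((fun z : ℂ => (z : OnePoint ℂ)) '' annularRing r)
      = (fun z : ℂ => (z : OnePoint ℂ)) '' closure (annularRing r) := by
    apply Set.Subset.antisymm
    · refine closure_minimal (Set.image_mono subset_closure) (IsCompact.isClosed ?_)
      refine IsCompact.image ?_ hemb.continuous
      refine (isCompact_closedBall (0 : ℂ) 1).of_isClosed_subset isClosed_closure ?_
      rw [closure_annularRing hr hr1]
      exact fun z hz => by simpa using hz.2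
    · exact image_closure_subset_closure_image hemb.continuous
  rw [(hemb.isOpenMap _ (isOpen_annularRing r)).frontier_eq, hcl,
    ← Set.image_sdiff hemb.injective, ← (isOpen_annularRing r).frontier_eq,
    frontier_annularRing hr hr1]

end Boundary

/-! ### Normalization of the two points and assembly of the formula. -/

/-- Two points can be moved by a linear isometry to `|x|` and `|y| e^{μi}`. -/
theorem exists_isometry_polar {x y : ℂ} (hx : x ≠ 0) (hy : y ≠ 0) :
    ∃ L : ℂ ≃ₗᵢ[ℝ] ℂ, L x = ‖x‖ ∧
      L y = ‖y‖ * Complex.exp ((InnerProductGeometry.angle x y : ℂ) * Complex.I) := by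
  have hx' : (‖x‖ : ℂ) ≠ 0 := by simpa using hx
  have h1 : rotation (Circle.exp (-Complex.arg x)) x = ‖x‖ := by
    rw [rotation_apply, Circle.coe_exp]
    nth_rw 2 [← Complex.norm_mul_exp_arg_mul_I x]
    rw [mul_left_comm, ← Complex.exp_add]
    simp
  have h2 : rotation (Circle.exp (-Complex.arg x)) y
      = ‖y‖ * Complex.exp ((Complex.arg (y / x) : ℂ) * Complex.I) := by
    have e := Complex.norm_mul_exp_arg_mul_I (y / x)
    rw [norm_div, Complex.ofReal_div, div_mul_eq_mul_div, div_eq_div_iff hx' hx] at e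
    rw [rotation_apply] at h1 ⊢
    apply mul_right_cancel₀ hx
    rw [e, ← h1]
    ring
  rw [InnerProductGeometry.angle_comm, Complex.angle_eq_abs_arg hy hx]
  -- The unsigned angle is `|arg (y / x)|`, so a negative argument calls for an extra conjugation.
  rcases le_total 0 (Complex.arg (y / x)) with h | h
  · exact ⟨rotation (Circle.exp (-Complex.arg x)), h1, by rw [h2, abs_of_nonneg h]⟩
  · refine ⟨(rotation (Circle.exp (-Complex.arg x))).trans Complex.conjLIE, ?_, ?_⟩
    · simp only [LinearIsometryEquiv.trans_apply, h1, Complex.conjLIE_apply,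
        Complex.conj_ofReal]
    · simp only [LinearIsometryEquiv.trans_apply, h2, Complex.conjLIE_apply, map_mul,
        Complex.conj_ofReal, ← Complex.exp_conj, Complex.conj_I, abs_of_nonpos h,
        Complex.ofReal_neg, neg_mul, mul_neg]

theorem exists_mixed_le_ringValue {r : ℝ} (hr : 0 < r) (hr1 : r < 1) {x y : ℂ}
    (hx : x ∈ annularRing r) (hy : y ∈ annularRing r) (hxy : ‖y‖ ≤ ‖x‖) :
    ∃ w ∈ Set.Icc (InnerProductGeometry.angle x y) Real.pi, ∀ a b : ℂ,
      (‖a‖ = 1 ∧ ‖b‖ = r ∨ ‖a‖ = r ∧ ‖b‖ = 1) →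
        Real.log (1 + absCrossRatio (a : OnePoint ℂ) (x : OnePoint ℂ) (b : OnePoint ℂ)
          (y : OnePoint ℂ)) ≤ ringValue r x y w := by
  obtain ⟨L, hLx, hLy⟩ := exists_isometry_polar (norm_pos_iff.1 (hr.trans hx.1))
    (norm_pos_iff.1 (hr.trans hy.1))
  obtain ⟨w, hw, hmax⟩ := exists_outer_inner_max hr hr1 hx.1 hx.2 hy.1
    ⟨InnerProductGeometry.angle_nonneg x y, InnerProductGeometry.angle_le_pi x y⟩
  refine ⟨w, hw, fun a b hab => ?_⟩
  rw [← absCrossRatio_map L.isometry, hLx, hLy]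
  refine Real.log_le_log (by rw [absCrossRatio_coe]; positivity) (add_le_add_right ?_ 1)
  rcases hab with ⟨ha, hb⟩ | ⟨ha, hb⟩
  · exact hmax _ _ (by rwa [L.norm_map]) (by rwa [L.norm_map])
  · refine (inner_outer_le_outer_inner hr hr1 hy.1 hxy hx.2 (by rwa [L.norm_map])
      (by rwa [L.norm_map])).trans (hmax _ _ ?_ ?_)
    · rw [norm_mul, Complex.norm_exp_ofReal_mul_I, Complex.norm_conj, L.norm_map, hb, one_mul]
    · rw [norm_mul, Complex.norm_exp_ofReal_mul_I, Complex.norm_conj, L.norm_map, ha, one_mul]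

theorem exists_boundary_eq_ringValue {r : ℝ} (hr : 0 < r) {x y : ℂ} (hx : x ≠ 0) (hy : y ≠ 0)
    (v : ℝ) :
    ∃ a b : ℂ, ‖a‖ = 1 ∧ ‖b‖ = r ∧ ringValue r x y v
      = Real.log (1 + absCrossRatio (a : OnePoint ℂ) (x : OnePoint ℂ) (b : OnePoint ℂ)
          (y : OnePoint ℂ)) := by
  obtain ⟨L, hLx, hLy⟩ := exists_isometry_polar hx hy
  refine ⟨L.symm (Complex.exp (-(ringAngle r ‖x‖ v : ℂ) * Complex.I)),
    L.symm ((r : ℂ) * Complex.exp ((v : ℂ) * Complex.I)), ?_, ?_, ?_⟩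
  · rw [L.symm.norm_map, ← Complex.ofReal_neg, Complex.norm_exp_ofReal_mul_I]
  · rw [L.symm.norm_map, norm_mul, Complex.norm_exp_ofReal_mul_I, mul_one,
      Complex.norm_of_nonneg hr.le]
  · rw [← absCrossRatio_map L.isometry, hLx, hLy, L.apply_symm_apply, L.apply_symm_apply]
    rfl

theorem mainTheorem1 (r : ℝ) (hr : 0 < r) (hr1 : r < 1) (x y : ℂ)
    (hx : x ∈ annularRing r) (hy : y ∈ annularRing r) (hxy : ‖y‖ ≤ ‖x‖) :
    -- the quantities in the formula are well defined
    (∀ v ∈ Set.Icc (InnerProductGeometry.angle x y) Real.pi,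
      0 < coeffOne r ‖x‖ v ∧ 0 ≤ ringDiscr r ‖x‖ v ∧ ringRoot r ‖x‖ v ∈ Set.Icc (0 : ℝ) 1) ∧
    BddAbove (mobiusValues ((fun z : ℂ => (z : OnePoint ℂ)) '' annularRing r) x y) ∧
    BddAbove (ringValue r x y '' Set.Icc (InnerProductGeometry.angle x y) Real.pi) ∧
    -- the formula
    mobiusMetric ((fun z : ℂ => (z : OnePoint ℂ)) '' annularRing r) x y =
      max (diskHypDist x y)
        (max
          (diskHypDist ((r : ℂ) * x / (‖x‖ : ℂ) ^ 2) ((r : ℂ) * y / (‖y‖ : ℂ) ^ 2))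
          (sSup (ringValue r x y '' Set.Icc (InnerProductGeometry.angle x y) Real.pi))) := by
  have hx0 : 0 < ‖x‖ := hr.trans hx.1
  have hy0 : 0 < ‖y‖ := hr.trans hy.1
  have hxne := norm_pos_iff.1 hx0
  have hyne := norm_pos_iff.1 hy0
  rw [ringReflection_eq, ringReflection_eq]
  have hx' : ‖(r : ℂ) / conj x‖ < 1 := by
    rw [norm_ringReflection hr]; exact (div_lt_one hx0).2 hx.1
  have hy' : ‖(r : ℂ) / conj y‖ < 1 := by
    rw [norm_ringReflection hr]; exact (div_lt_one hy0).2 hy.1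
  have hne : ∀ {c : ℂ} {ρ : ℝ}, 0 < ρ → ‖c‖ = ρ → c ≠ 0 := fun {c ρ} hρ h =>
    norm_pos_iff.1 (h ▸ hρ)
  set D := mobiusValues ((fun z : ℂ => (z : OnePoint ℂ)) '' annularRing r) x y with hD
  set V := ringValue r x y '' Set.Icc (InnerProductGeometry.angle x y) Real.pi with hV
  have hmem : ∀ a b : ℂ, (‖a‖ = r ∨ ‖a‖ = 1) → (‖b‖ = r ∨ ‖b‖ = 1) →
      Real.log (1 + absCrossRatio (a : OnePoint ℂ) (x : OnePoint ℂ) (b : OnePoint ℂ)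
        (y : OnePoint ℂ)) ∈ D := fun a b ha hb => by
    refine ⟨a, ?_, b, ?_, rfl⟩ <;> rw [frontier_image_annularRing hr hr1]
    exacts [⟨a, ha, rfl⟩, ⟨b, hb, rfl⟩]
  obtain ⟨w, hw, hmix⟩ := exists_mixed_le_ringValue hr hr1 hx hy hxy
  -- Each `ringValue` comes from an actual mixed boundary pair, so the bound over mixed pairs also
  -- shows that `w` maximizes `ringValue`.
  have hVw : IsGreatest V (ringValue r x y w) := by
    refine ⟨⟨w, hw, rfl⟩, ?_⟩
    rintro _ ⟨v, -, rfl⟩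
    obtain ⟨a, b, ha, hb, h⟩ := exists_boundary_eq_ringValue hr hxne hyne v
    rw [h]
    exact hmix a b (Or.inl ⟨ha, hb⟩)
  rw [hVw.csSup_eq]
  have hDmax : IsGreatest D (max (diskHypDist x y)
      (max (diskHypDist ((r : ℂ) / conj x) ((r : ℂ) / conj y)) (ringValue r x y w))) := by
    constructor
    · refine max_rec' (· ∈ D) ?_ (max_rec' (· ∈ D) ?_ ?_)
      · obtain ⟨a, b, ha, hb, h⟩ := exists_log_absCrossRatio_eq_diskHypDist hx.2 hy.2
        exact h ▸ hmem a b (Or.inr ha) (Or.inr hb)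
      · obtain ⟨a, b, ha, hb, h⟩ := exists_log_absCrossRatio_eq_diskHypDist hx' hy'
        rw [← h]
        have hinv : ∀ {c : ℂ}, ‖c‖ = 1 → ‖(r : ℂ) / conj c‖ = r := fun {c} hc => by
          rw [norm_ringReflection hr, hc, div_one]
        have := absCrossRatio_ringReflection hr (hne hr (hinv ha)) hxne (hne hr (hinv hb)) hyne
        rw [ringReflection_ringReflection hr.ne', ringReflection_ringReflection hr.ne'] at this
        rw [this]
        exact hmem _ _ (Or.inl (hinv ha)) (Or.inl (hinv hb))
      · obtain ⟨a, b, ha, hb, h⟩ := exists_boundary_eq_ringValue hr hxne hyne w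
        exact h ▸ hmem a b (Or.inr ha) (Or.inl hb)
    · rintro _ ⟨a, ha, b, hb, rfl⟩
      rw [frontier_image_annularRing hr hr1] at ha hb
      obtain ⟨a, ha, rfl⟩ := ha
      obtain ⟨b, hb, rfl⟩ := hb
      rcases ha with ha | ha <;> rcases hb with hb | hb
      · refine le_max_of_le_right (le_max_of_le_left ?_)
        dsimp only
        rw [← absCrossRatio_ringReflection hr (hne hr ha) hxne (hne hr hb) hyne]
        have hinv : ∀ {c : ℂ}, ‖c‖ = r → ‖(r : ℂ) / conj c‖ = 1 := fun {c} hc => by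
          rw [norm_ringReflection hr, hc, div_self hr.ne']
        exact log_absCrossRatio_le_diskHypDist hx' hy' (hinv ha) (hinv hb)
      · exact le_max_of_le_right (le_max_of_le_right (hmix a b (Or.inr ⟨ha, hb⟩)))
      · exact le_max_of_le_right (le_max_of_le_right (hmix a b (Or.inl ⟨ha, hb⟩)))
      · exact le_max_of_le_left (log_absCrossRatio_le_diskHypDist hx.2 hy.2 ha hb)
  refine ⟨fun v hv => ?_, hDmax.bddAbove, hVw.bddAbove, hDmax.csSup_eq⟩
  exact ⟨coeffOne_pos hr hx.1 hx.2 v, ringDiscr_nonneg hr hx.1 hx.2 v,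
    ringRoot_mem_Icc hr hx.1 hx.2 ⟨(InnerProductGeometry.angle_nonneg x y).trans hv.1, hv.2⟩⟩
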